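/- Let $E$ be a locally compact second countable Hausdorff space with its Borel $\sigma$-algebra. Let $\bar N(E)$ be the set of all finite counting measures $\xi=\sum_{i=1}^k\delta_{x_i}$ with $k\in\mathbb N_0$ and $x_i\in E$ (points may be repeated), with the $\sigma$-algebra generated by the maps $\xi\mapsto\xi(B)$, $B\subseteq E$ Borel. For $\xi,\nu\in\bar N(E)$ put $$\xi\setminus\nu=\sum_{x:\ \xi(\{x\})>0}\bigl(\xi(\{x\})-\nu(\{x\})\bigr)_+\,\delta_x ,$$ and for $A\subseteq\bar N(E)$ and $s\ge 0$ put $$d_T^\pi(\xi,A)=\sup_{\alpha}\ \inf_{\nu\in A}\int\alpha\,d(\xi\setminus\nu),\qquad A_s^\pi=\{\xi\in\bar N(E):\ d_T^\pi(\xi,A)\le s\},$$ where the supremum is over all functions $\alpha:E\to[0,\infty)$ with $\|\alpha\|_{2,\xi}^2=\int\alpha^2\,d\xi\le 1$, and $\inf\emptyset=\infty$. Let $\eta$ be a Poisson point process on $E$ with finite intensity measure $\Lambda$, that is, a random element of $\bar N(E)$ such that $\eta(B)$ is Poisson distributed with parameter $\Lambda(B)$ for every Borel set $B\subseteq E$ and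 $\eta(B_1),\dots,\eta(B_n)$ are independent for all pairwise disjoint Borel sets $B_1,\dots,B_n$. Then for every measurable $A\subseteq\bar N(E)$ and every real $s\ge 0$, $$\mathbb P(\eta\in A)\,\mathbb P(\eta\notin A_s^\pi)\le e^{-s^2/4},$$ where $\mathbb P(\eta\notin A_s^\pi)$ is read as outer probability if the event is not measurable. -/

import Mathlib

open MeasureTheory ProbabilityTheory
open scoped NNReal ENNReal

noncomputable section

/-- The space of finite counting measures `δ_{x₁} + ⋯ + δ_{xₖ}`, `k ≥ 0`, on `E`
(the points need not be distinct). -/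
def FiniteCountingMeasure (E : Type*) [MeasurableSpace E] : Type _ :=
  {ξ : Measure E // ∃ (k : ℕ) (x : Fin k → E), ξ = ∑ i, Measure.dirac (x i)}

namespace FiniteCountingMeasure

variable {E : Type*} [MeasurableSpace E]

/-- A finite counting measure, as a measure. -/
def toMeasure (ξ : FiniteCountingMeasure E) : Measure E := ξ.1

/-- The σ-algebra generated by the evaluation maps `ξ ↦ ξ B`, `B` measurable: the trace of the
usual σ-algebra on the space of measures. -/
instance instMeasurableSpace : MeasurableSpace (FiniteCountingMeasure E) :=
  MeasurableSpace.comap toMeasure Measure.instMeasurableSpace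

/-- The difference `ξ ∖ ν = ∑_{x : ξ{x} > 0} (ξ{x} - ν{x})₊ δ_x`. (Subtraction on `ℝ≥0∞` is
truncated at `0`.) -/
def diff (ξ ν : FiniteCountingMeasure E) : Measure E :=
  Measure.sum fun x : {x : E // 0 < ξ.toMeasure {x}} =>
    (ξ.toMeasure {x.1} - ν.toMeasure {x.1}) • Measure.dirac x.1

/-- The convex distance from `ξ` to `A`: the supremum over all functions `α ≥ 0` with
`∫ α² dξ ≤ 1` of the infimum over `ν ∈ A` of `∫ α d(ξ ∖ ν)`. It is `∞` if `A` is empty. -/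
def convexDist (ξ : FiniteCountingMeasure E) (A : Set (FiniteCountingMeasure E)) : ℝ≥0∞ :=
  ⨆ (α : E → ℝ≥0) (_ : ∫⁻ x, (α x : ℝ≥0∞) ^ 2 ∂ξ.toMeasure ≤ 1),
    ⨅ ν ∈ A, ∫⁻ x, (α x : ℝ≥0∞) ∂(ξ.diff ν)

/-- The `s`-parallel set of `A` with respect to the convex distance. -/
def parallelSet (A : Set (FiniteCountingMeasure E)) (s : ℝ) : Set (FiniteCountingMeasure E) :=
  {ξ | ξ.convexDist A ≤ ENNReal.ofReal s}

end FiniteCountingMeasure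

/-- `η` is, under `P`, a Poisson point process on `E` with finite intensity measure `Λ`:
a random finite counting measure such that `η(B)` is Poisson distributed with parameter `Λ(B)` for
every measurable `B`, and `η(B₁), …, η(Bₙ)` are independent for pairwise disjoint measurable
`B₁, …, Bₙ`. -/
structure IsPoissonProcess {Ω E : Type*} [MeasurableSpace Ω] [MeasurableSpace E]
    (η : Ω → FiniteCountingMeasure E) (Λ : Measure E) [IsFiniteMeasure Λ] (P : Measure Ω) :
    Prop where
  measurable : Measurable η
  map_eq : ∀ B : Set E, MeasurableSet B →
    P.map (fun ω => (η ω).toMeasure B) =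
      (poissonMeasure (Λ B).toNNReal).map (fun k : ℕ => (k : ℝ≥0∞))
  iIndepFun : ∀ (n : ℕ) (B : Fin n → Set E), (∀ i, MeasurableSet (B i)) →
    Pairwise (fun i j => Disjoint (B i) (B j)) →
    iIndepFun (fun i ω => (η ω).toMeasure (B i)) P

end

/-! Talagrand's inequality for n independent points has a constant that does not depend on n, and a
Poisson process is a limit of binomial processes. For tuples, the squared convex distance d² is the
least squared norm on a convex hull of separation vectors, and induction on n gives ∫ exp(d²/4) ≤
1/P(A) for compact A (`lintegral_exp_sqDist_le`): a first coordinate is either kept for free or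
replaced at cost 1, the two options are mixed with weight θ, and Hölder's inequality is applied with
a good θ. Markov's inequality yields the tail bound (`measure_mul_measure_le`).

A tuple in `E ⊕ Unit` is sent to the counting measure of its entries in `E`; the additional point
stands for an absent one. Changing a tuple costs at least as much as changing its counting measure,
so counting measures outside the parallel set come from tuples far from the preimage of A
(`exists_weights`), and the bound transfers (`map_ofPoints_mul_le`).

Let r = Λ(E) + 1 and let M_k be the law of the counting measure of k independent points of law
`pointLaw Λ`. Characteristic functionals show that the Poisson process is the Poisson(r) mixture of
the M_k (`map_poisson_eq_sum`), and that n points diluted with parameter r/n give the binomial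
mixture of the same M_k (`map_ofPoints_dilutedLaw`). Only the weights depend on n, and they
converge, so the inequality passes to the limit on arbitrary sets. The parallel set is never shown
to be measurable; `map_ofPoints_apply_le` controls its outer measure. -/

noncomputable section

namespace ConvexDistance

/-! ### Convex distance on tuples and its recursion in the dimension -/

section Deterministic

variable {X : Type*} {n : ℕ}

/-- The nonnegative vectors that are at least `1` in every coordinate where `x` differs from some
fixed point of `A`. -/
def separationSet (x : Fin n → X) (A : Set (Fin n → X)) : Set (Fin n → ℝ) :=
  {z | ∃ y ∈ A, ∀ i, 0 ≤ z i ∧ (x i ≠ y i → 1 ≤ z i)}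

/-- The square of Talagrand's convex distance from `x` to `A`, in its dual form: the least squared
Euclidean norm on the convex hull of `separationSet x A`. -/
def sqDist (x : Fin n → X) (A : Set (Fin n → X)) : ℝ :=
  sInf ((fun z : Fin n → ℝ => ∑ i, z i ^ 2) '' convexHull ℝ (separationSet x A))

lemma bddBelow_sqNorm_image (S : Set (Fin n → ℝ)) :
    BddBelow ((fun z : Fin n → ℝ => ∑ i, z i ^ 2) '' S) :=
  ⟨0, by rintro _ ⟨z, -, rfl⟩; exact Finset.sum_nonneg fun i _ => sq_nonneg _⟩

lemma separationSet_nonempty (x : Fin n → X) {A : Set (Fin n → X)} (hA : A.Nonempty) :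
    (separationSet x A).Nonempty :=
  let ⟨y, hy⟩ := hA
  ⟨fun _ => 1, y, hy, fun _ => ⟨zero_le_one, fun _ => le_rfl⟩⟩

lemma sqDist_le_of_mem {x : Fin n → X} {A : Set (Fin n → X)} {z : Fin n → ℝ}
    (hz : z ∈ convexHull ℝ (separationSet x A)) : sqDist x A ≤ ∑ i, z i ^ 2 :=
  csInf_le (bddBelow_sqNorm_image _) ⟨z, hz, rfl⟩

lemma exists_mem_sqNorm_lt (x : Fin n → X) {A : Set (Fin n → X)} (hA : A.Nonempty)
    {c : ℝ} (hc : sqDist x A < c) :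
    ∃ z ∈ convexHull ℝ (separationSet x A), ∑ i, z i ^ 2 < c := by
  obtain ⟨_, ⟨z, hz, rfl⟩, h⟩ := exists_lt_of_csInf_lt
    (((separationSet_nonempty x hA).mono (subset_convexHull ℝ _)).image _) hc
  exact ⟨z, hz, h⟩

/-- The easy half of the duality between the two descriptions of the convex distance. -/
lemma sq_le_sqDist {x : Fin n → X} {A : Set (Fin n → X)} (hA : A.Nonempty) {a : Fin n → ℝ}
    (ha : ∀ i, 0 ≤ a i) (ha' : ∑ i, a i ^ 2 ≤ 1) {c : ℝ} (hc : 0 ≤ c) [DecidableEq X]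
    (h : ∀ y ∈ A, c ≤ ∑ i, if x i ≠ y i then a i else 0) : c ^ 2 ≤ sqDist x A := by
  refine le_csInf (((separationSet_nonempty x hA).mono (subset_convexHull ℝ _)).image _) ?_
  rintro _ ⟨z, hz, rfl⟩
  -- The half-space a·z ≥ c contains all separation vectors, hence their convex hull; Cauchy–Schwarz
  -- then bounds the norm of z.
  have hcz : c ≤ ∑ i, a i * z i := by
    have hconv : Convex ℝ {z : Fin n → ℝ | c ≤ ∑ i, a i * z i} := by
      refine convex_halfSpace_ge (f := fun z : Fin n → ℝ => ∑ i, a i * z i) ⟨?_, ?_⟩ c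
      · intro u v
        simp [mul_add, Finset.sum_add_distrib]
      · intro t u
        simp only [Pi.smul_apply, smul_eq_mul, Finset.mul_sum]
        exact Finset.sum_congr rfl fun i _ => by ring
    refine convexHull_min ?_ hconv hz
    rintro u ⟨y, hy, hu⟩
    refine (h y hy).trans (Finset.sum_le_sum fun i _ => ?_)
    split_ifs with hi
    · exact le_mul_of_one_le_right (ha i) ((hu i).2 hi)
    · exact mul_nonneg (ha i) (hu i).1
  calc c ^ 2 ≤ (∑ i, a i * z i) ^ 2 := by gcongr
    _ ≤ (∑ i, a i ^ 2) * ∑ i, z i ^ 2 := Finset.sum_mul_sq_le_sq_mul_sq _ _ _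
    _ ≤ 1 * ∑ i, z i ^ 2 := by
        gcongr
    _ = ∑ i, z i ^ 2 := one_mul _

/-- Prepending a fixed c is an affine map, so it suffices to check the generators of the hull. -/
lemma cons_mem_convexHull {w : X} {x : Fin n → X} {A : Set (Fin (n + 1) → X)}
    {C : Set (Fin n → X)} {c : ℝ}
    (h : ∀ z ∈ separationSet x C, (Fin.cons c z : Fin (n + 1) → ℝ) ∈
      separationSet (Fin.cons w x : Fin (n + 1) → X) A)
    {z : Fin n → ℝ} (hz : z ∈ convexHull ℝ (separationSet x C)) :
    (Fin.cons c z : Fin (n + 1) → ℝ) ∈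
      convexHull ℝ (separationSet (Fin.cons w x : Fin (n + 1) → X) A) := by
  have hconv : Convex ℝ {z : Fin n → ℝ | (Fin.cons c z : Fin (n + 1) → ℝ) ∈
      convexHull ℝ (separationSet (Fin.cons w x : Fin (n + 1) → X) A)} := by
    refine fun u hu v hv s t hs ht hst => ?_
    have := (convex_convexHull ℝ _) hu hv hs ht hst
    have hcons : (Fin.cons c (s • u + t • v) : Fin (n + 1) → ℝ) =
        s • (Fin.cons c u : Fin (n + 1) → ℝ) + t • (Fin.cons c v : Fin (n + 1) → ℝ) := ?_
    · rw [Set.mem_ofPred_eq, hcons]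
      exact this
    ext i
    refine Fin.cases ?_ (fun j => ?_) i
    · simp [← add_mul, hst]
    · simp
  refine convexHull_min (fun u hu => ?_) hconv hz
  exact subset_convexHull ℝ _ (h u hu)

lemma cons_zero_mem {w : X} {x : Fin n → X} {A : Set (Fin (n + 1) → X)} {z : Fin n → ℝ}
    (hz : z ∈ convexHull ℝ (separationSet x {y | (Fin.cons w y : Fin (n + 1) → X) ∈ A})) :
    (Fin.cons 0 z : Fin (n + 1) → ℝ) ∈
      convexHull ℝ (separationSet (Fin.cons w x : Fin (n + 1) → X) A) := by
  refine cons_mem_convexHull ?_ hz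
  rintro u ⟨y, hy, hu⟩
  refine ⟨_, hy, fun i => ?_⟩
  refine Fin.cases ?_ (fun j => ?_) i
  · simp
  · simpa using hu j

lemma cons_one_mem {w : X} {x : Fin n → X} {A : Set (Fin (n + 1) → X)} {z : Fin n → ℝ}
    (hz : z ∈ convexHull ℝ (separationSet x (Fin.tail '' A))) :
    (Fin.cons 1 z : Fin (n + 1) → ℝ) ∈
      convexHull ℝ (separationSet (Fin.cons w x : Fin (n + 1) → X) A) := by
  refine cons_mem_convexHull ?_ hz
  rintro u ⟨_, ⟨y, hy, rfl⟩, hu⟩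
  refine ⟨y, hy, fun i => ?_⟩
  refine Fin.cases ?_ (fun j => ?_) i
  · simp
  · simpa [Fin.tail] using hu j

lemma sqDist_cons_le_one_add (w : X) (x : Fin n → X) {A : Set (Fin (n + 1) → X)}
    (hA : A.Nonempty) :
    sqDist (Fin.cons w x : Fin (n + 1) → X) A ≤ 1 + sqDist x (Fin.tail '' A) := by
  refine le_of_forall_pos_le_add fun ε hε => ?_
  obtain ⟨z, hz, hlt⟩ := exists_mem_sqNorm_lt x (hA.image _)
    (lt_add_of_pos_right (sqDist x (Fin.tail '' A)) hε)
  have := sqDist_le_of_mem (cons_one_mem (w := w) hz)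
  rw [Fin.sum_univ_succ] at this
  simp only [Fin.cons_zero, Fin.cons_succ] at this
  linarith

/-- Mix a vector keeping the first coordinate (entry 0) with one replacing it (entry 1): the mixture
has first entry 1 - θ, and convexity of the square handles the rest. -/
lemma sqDist_cons_le (w : X) (x : Fin n → X) {A : Set (Fin (n + 1) → X)}
    (hA : {y : Fin n → X | (Fin.cons w y : Fin (n + 1) → X) ∈ A}.Nonempty) {θ : ℝ}
    (h0 : 0 ≤ θ) (h1 : θ ≤ 1) :
    sqDist (Fin.cons w x : Fin (n + 1) → X) A ≤ (1 - θ) ^ 2 +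
      θ * sqDist x {y | (Fin.cons w y : Fin (n + 1) → X) ∈ A} +
      (1 - θ) * sqDist x (Fin.tail '' A) := by
  have hB : (Fin.tail '' A).Nonempty := let ⟨y, hy⟩ := hA; ⟨_, _, hy, rfl⟩
  refine le_of_forall_pos_le_add fun ε hε => ?_
  obtain ⟨u, hu, hul⟩ := exists_mem_sqNorm_lt x hA (lt_add_of_pos_right _ hε)
  obtain ⟨v, hv, hvl⟩ := exists_mem_sqNorm_lt x hB (lt_add_of_pos_right _ hε)
  have := sqDist_le_of_mem ((convex_convexHull ℝ _) (cons_zero_mem hu) (cons_one_mem (w := w) hv)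
    h0 (sub_nonneg.2 h1) (by ring))
  rw [Fin.sum_univ_succ] at this
  simp only [Pi.add_apply, Pi.smul_apply, Fin.cons_zero, Fin.cons_succ, smul_eq_mul, mul_zero,
    mul_one, zero_add] at this
  have hsum : ∑ i, (θ * u i + (1 - θ) * v i) ^ 2 ≤
      θ * ∑ i, u i ^ 2 + (1 - θ) * ∑ i, v i ^ 2 := by
    rw [Finset.mul_sum, Finset.mul_sum, ← Finset.sum_add_distrib]
    refine Finset.sum_le_sum fun i _ => ?_
    nlinarith [mul_nonneg (mul_nonneg h0 (sub_nonneg.2 h1)) (sq_nonneg (u i - v i))]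
  have h3 := mul_le_mul_of_nonneg_left hul.le h0
  have h4 := mul_le_mul_of_nonneg_left hvl.le (sub_nonneg.2 h1)
  linarith

/-- The set depends on x only through the family of those I off which x agrees with a point of A.
There are finitely many such families, which is what makes `sqDist` measurable. -/
lemma separationSet_eq (x : Fin n → X) (A : Set (Fin n → X)) :
    separationSet x A = {z | ∃ I : Set (Fin n), (∃ y ∈ A, ∀ i ∉ I, x i = y i) ∧
      ∀ i, 0 ≤ z i ∧ (i ∈ I → 1 ≤ z i)} := by
  ext z
  constructor
  · rintro ⟨y, hy, hz⟩
    exact ⟨{i | x i ≠ y i}, ⟨y, hy, fun i hi => by simpa using hi⟩, hz⟩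
  · rintro ⟨I, ⟨y, hy, hI⟩, hz⟩
    exact ⟨y, hy, fun i => ⟨(hz i).1, fun h => (hz i).2 (by_contra fun hi => h (hI i hi))⟩⟩

end Deterministic

/-! ### Scalar inequalities for the induction -/

lemma exp_sub_sq_add_exp_neg_le {u : ℝ} (h0 : 0 ≤ u) (h1 : u ≤ 1) :
    Real.exp (u - u ^ 2) + Real.exp (-u) ≤ 2 := by
  have key : Real.exp (u - u ^ 2) + Real.exp (-u) =
      2 * (Real.exp (-u ^ 2 / 2) * Real.cosh (u - u ^ 2 / 2)) := by
    rw [Real.cosh_eq, mul_div_assoc', mul_div_cancel₀ _ two_ne_zero, mul_add, ← Real.exp_add,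
      ← Real.exp_add]
    congr 2 <;> ring
  have h2 : Real.exp (-u ^ 2 / 2) * Real.cosh (u - u ^ 2 / 2) ≤ 1 := by
    calc _ ≤ Real.exp (-u ^ 2 / 2) * Real.exp ((u - u ^ 2 / 2) ^ 2 / 2) := by
          gcongr
          exact Real.cosh_le_exp_half_sq _
      _ = Real.exp (-(u ^ 3 * (1 - u / 4) / 2)) := by
          rw [← Real.exp_add]
          congr 1
          ring
      _ ≤ 1 := by
          rw [Real.exp_le_one_iff, neg_nonpos]
          have : 0 ≤ 1 - u / 4 := by linarith
          positivity
  linarith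

lemma exp_quarter_le : Real.exp (1 / 4) ≤ 4 / 3 := by
  have h := Real.one_sub_le_exp_neg (1 / 4)
  rw [Real.exp_neg] at h
  have := inv_anti₀ (by norm_num) h
  rw [inv_inv] at this
  linarith

/-- The one-dimensional inequality behind the induction step. -/
lemma exists_rpow_mul_exp_le {r : ℝ} (h0 : 0 < r) (h1 : r ≤ 1) :
    ∃ θ : ℝ, 0 ≤ θ ∧ θ ≤ 1 ∧ r ^ (-θ) * Real.exp ((1 - θ) ^ 2 / 4) ≤ 2 - r := by
  rcases le_total (Real.exp (-(1 / 2))) r with h | h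
  · have hl : -(1 / 2) ≤ Real.log r := (Real.le_log_iff_exp_le h0).2 h
    have hl0 : Real.log r ≤ 0 := Real.log_nonpos h0.le h1
    -- This θ minimises -θ log r + (1 - θ)²/4; it is nonnegative exactly when r ≥ exp(-1/2). With u
    -- = -log r the minimum is u - u².
    refine ⟨1 + 2 * Real.log r, by linarith, by linarith, ?_⟩
    have := exp_sub_sq_add_exp_neg_le (u := -Real.log r) (by linarith) (by linarith)
    rw [neg_neg, Real.exp_log h0] at this
    rw [Real.rpow_def_of_pos h0, ← Real.exp_add]
    refine le_trans (le_of_eq ?_) (by linarith : Real.exp (-Real.log r - (-Real.log r) ^ 2) ≤ _)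
    congr 1
    ring
  -- For small r the endpoint suffices: exp(1/4) ≤ 4/3 = 2 - 2/3 ≤ 2 - r.
  · refine ⟨0, le_rfl, zero_le_one, ?_⟩
    have h2 : Real.exp (-(1 / 2)) ≤ 2 / 3 := by
      have h := Real.add_one_le_exp (1 / 2 : ℝ)
      rw [Real.exp_neg]
      have := inv_anti₀ (by norm_num) h
      linarith
    have := exp_quarter_le
    norm_num at *
    linarith

/-! ### Talagrand's inequality for product measures -/

section Measure

variable {X : Type*} [TopologicalSpace X] [PolishSpace X] [MeasurableSpace X] [BorelSpace X]

/-- Compactness makes each projection of A closed, so each predicate "x agrees with a point of A off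
I" defines a closed set. -/
lemma measurable_sqDist {n : ℕ} {A : Set (Fin n → X)} (hA : IsCompact A) :
    Measurable fun x => sqDist x A := by
  let G : (Set (Fin n) → Prop) → ℝ := fun p =>
    sInf ((fun z : Fin n → ℝ => ∑ i, z i ^ 2) '' convexHull ℝ
      {z | ∃ I : Set (Fin n), p I ∧ ∀ i, 0 ≤ z i ∧ (i ∈ I → 1 ≤ z i)})
  have hG : (fun x => sqDist x A) = G ∘ fun x I => ∃ y ∈ A, ∀ i ∉ I, x i = y i := by
    ext x
    simp only [sqDist, separationSet_eq, Function.comp_apply, G]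
  rw [hG]
  refine (measurable_of_countable G).comp (measurable_pi_iff.2 fun I => ?_)
  refine measurableSet_setOfPred.1 (IsClosed.measurableSet ?_)
  have hcont : Continuous fun (x : Fin n → X) (i : (Iᶜ : Set (Fin n))) => x i := by fun_prop
  have : {x : Fin n → X | ∃ y ∈ A, ∀ i ∉ I, x i = y i} =
      (fun x (i : (Iᶜ : Set (Fin n))) => x i) ⁻¹'
        ((fun (x : Fin n → X) (i : (Iᶜ : Set (Fin n))) => x i) '' A) := by
    ext x
    simp only [Set.mem_ofPred_eq, Set.mem_preimage, Set.mem_image]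
    refine exists_congr fun y => and_congr_right fun _ => ?_
    rw [funext_iff]
    simp [eq_comm]
  rw [this]
  exact ((hA.image hcont).isClosed).preimage hcont

omit [TopologicalSpace X] [PolishSpace X] [BorelSpace X] in
lemma map_cons_pi (μ : Measure X) [IsProbabilityMeasure μ] (n : ℕ) :
    MeasurePreserving (fun p : X × (Fin n → X) => (Fin.cons p.1 p.2 : Fin (n + 1) → X))
      (μ.prod (Measure.pi fun _ => μ)) (Measure.pi fun _ => μ) := by
  have h : (fun p : X × (Fin n → X) => (Fin.cons p.1 p.2 : Fin (n + 1) → X)) =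
      (MeasurableEquiv.piFinSuccAbove (fun _ => X) 0).symm := by
    ext p i
    simp [MeasurableEquiv.piFinSuccAbove]
  rw [h]
  exact (measurePreserving_piFinSuccAbove (fun _ : Fin (n + 1) => μ) 0).symm

omit [MeasurableSpace X] [BorelSpace X] in
lemma isCompact_section {n : ℕ} {A : Set (Fin (n + 1) → X)} (hA : IsCompact A) (w : X) :
    IsCompact {y : Fin n → X | (Fin.cons w y : Fin (n + 1) → X) ∈ A} := by
  have hcont : Continuous fun y : Fin n → X => (Fin.cons w y : Fin (n + 1) → X) := by fun_prop
  have htail : Continuous (Fin.tail : (Fin (n + 1) → X) → Fin n → X) := by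
    unfold Fin.tail; fun_prop
  refine (hA.image htail).of_isClosed_subset (hA.isClosed.preimage hcont) fun y hy => ?_
  exact ⟨_, hy, by simp⟩

/-- The conditional form of the induction step in Talagrand's inequality: the last factor is
integrated, the first coordinate is fixed. -/
lemma lintegral_exp_sqDist_cons_le (μ : Measure X) [IsProbabilityMeasure μ] {n : ℕ}
    (ih : ∀ C : Set (Fin n → X), IsCompact C →
      ∫⁻ x, ENNReal.ofReal (Real.exp (sqDist x C / 4)) ∂Measure.pi (fun _ => μ) ≤
        (Measure.pi (fun _ => μ) C)⁻¹)
    {A : Set (Fin (n + 1) → X)} (hA : IsCompact A) (hne : A.Nonempty) {b : ℝ} (hb : 0 < b)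
    (hB : (Measure.pi fun _ => μ).real (Fin.tail '' A) = b) (w : X) :
    ∫⁻ x, ENNReal.ofReal (Real.exp (sqDist (Fin.cons w x : Fin (n + 1) → X) A / 4))
        ∂Measure.pi (fun _ => μ) ≤
      ENNReal.ofReal ((2 - (Measure.pi fun _ => μ).real
        {y : Fin n → X | (Fin.cons w y : Fin (n + 1) → X) ∈ A} / b) / b) := by
  set Q : Measure (Fin n → X) := Measure.pi fun _ => μ
  set C : Set (Fin n → X) := {y | (Fin.cons w y : Fin (n + 1) → X) ∈ A} with hC
  set B : Set (Fin n → X) := Fin.tail '' A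
  have htail : Continuous (Fin.tail : (Fin (n + 1) → X) → Fin n → X) := by
    unfold Fin.tail; fun_prop
  have hBc : IsCompact B := hA.image htail
  have hCc : IsCompact C := isCompact_section hA w
  have hCB : C ⊆ B := fun y hy => ⟨_, hy, by simp⟩
  have hmB := measurable_sqDist hBc
  have hmC := measurable_sqDist hCc
  have hinv : ∀ D : Set (Fin n → X), 0 < Q.real D → (Q D)⁻¹ = ENNReal.ofReal (1 / Q.real D) := by
    intro D hD
    rw [one_div, ENNReal.ofReal_inv_of_pos hD, ofReal_measureReal]
  have ihB := ih B hBc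
  rw [hinv B (hB ▸ hb), hB] at ihB
  rcases (measureReal_nonneg (μ := Q) (s := C)).eq_or_lt with h0 | hpos
  -- A null section gives no usable bound, so the first coordinate is always replaced; the cost 1
  -- gives the factor exp(1/4) ≤ 2.
  · rw [← h0, zero_div, sub_zero]
    calc _ ≤ ∫⁻ x, ENNReal.ofReal (Real.exp (1 / 4)) *
          ENNReal.ofReal (Real.exp (sqDist x B / 4)) ∂Q := by
          refine lintegral_mono fun x => ?_
          rw [← ENNReal.ofReal_mul (Real.exp_nonneg _), ← Real.exp_add]
          have := sqDist_cons_le_one_add w x hne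
          refine ENNReal.ofReal_le_ofReal (Real.exp_le_exp.2 ?_)
          linarith
      _ = ENNReal.ofReal (Real.exp (1 / 4)) *
          ∫⁻ x, ENNReal.ofReal (Real.exp (sqDist x B / 4)) ∂Q :=
          lintegral_const_mul' _ _ ENNReal.ofReal_ne_top
      _ ≤ ENNReal.ofReal (Real.exp (1 / 4)) * ENNReal.ofReal (1 / b) := by gcongr
      _ ≤ ENNReal.ofReal (2 / b) := by
          rw [← ENNReal.ofReal_mul (Real.exp_nonneg _), ← mul_one_div 2 b]
          have := exp_quarter_le
          refine ENNReal.ofReal_le_ofReal ?_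
          gcongr
          linarith
  · have hCne : C.Nonempty := by
      by_contra h
      rw [Set.not_nonempty_iff_eq_empty] at h
      simp [h] at hpos
    set a := Q.real C
    have hab : a ≤ b := hB ▸ measureReal_mono hCB
    have ihC := ih C hCc
    rw [hinv C hpos] at ihC
    obtain ⟨θ, hθ0, hθ1, hθ⟩ := exists_rpow_mul_exp_le (div_pos hpos hb) ((div_le_one hb).2 hab)
    have hθ1' : 0 ≤ 1 - θ := sub_nonneg.2 hθ1
    calc _ ≤ ∫⁻ x, ENNReal.ofReal (Real.exp ((1 - θ) ^ 2 / 4)) *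
          (ENNReal.ofReal (Real.exp (sqDist x C / 4)) ^ θ *
            ENNReal.ofReal (Real.exp (sqDist x B / 4)) ^ (1 - θ)) ∂Q := by
          refine lintegral_mono fun x => ?_
          rw [ENNReal.ofReal_rpow_of_pos (Real.exp_pos _),
            ENNReal.ofReal_rpow_of_pos (Real.exp_pos _), ← ENNReal.ofReal_mul (by positivity),
            ← ENNReal.ofReal_mul (by positivity), ← Real.exp_mul, ← Real.exp_mul, ← Real.exp_add,
            ← Real.exp_add]
          have := sqDist_cons_le w x hCne hθ0 hθ1
          refine ENNReal.ofReal_le_ofReal (Real.exp_le_exp.2 ?_)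
          linarith
      _ = ENNReal.ofReal (Real.exp ((1 - θ) ^ 2 / 4)) *
          ∫⁻ x, ENNReal.ofReal (Real.exp (sqDist x C / 4)) ^ θ *
            ENNReal.ofReal (Real.exp (sqDist x B / 4)) ^ (1 - θ) ∂Q :=
          lintegral_const_mul' _ _ ENNReal.ofReal_ne_top
      _ ≤ ENNReal.ofReal (Real.exp ((1 - θ) ^ 2 / 4)) *
          ((∫⁻ x, ENNReal.ofReal (Real.exp (sqDist x C / 4)) ∂Q) ^ θ *
            (∫⁻ x, ENNReal.ofReal (Real.exp (sqDist x B / 4)) ∂Q) ^ (1 - θ)) := by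
          gcongr
          exact ENNReal.lintegral_mul_norm_pow_le (by fun_prop) (by fun_prop) hθ0 hθ1' (by ring)
      _ ≤ ENNReal.ofReal (Real.exp ((1 - θ) ^ 2 / 4)) *
          (ENNReal.ofReal (1 / a) ^ θ * ENNReal.ofReal (1 / b) ^ (1 - θ)) := by gcongr
      _ = ENNReal.ofReal (((a / b) ^ (-θ) * Real.exp ((1 - θ) ^ 2 / 4)) / b) := by
          rw [ENNReal.ofReal_rpow_of_pos (by positivity), ENNReal.ofReal_rpow_of_pos (by positivity),
            ← ENNReal.ofReal_mul (by positivity), ← ENNReal.ofReal_mul (by positivity)]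
          congr 1
          have h1 : (1 / b) ^ (1 - θ) = b ^ θ / b := by
            rw [one_div, Real.inv_rpow hb.le, ← Real.rpow_neg hb.le, neg_sub,
              Real.rpow_sub_one hb.ne']
          rw [h1, one_div, Real.inv_rpow hpos.le, Real.rpow_neg (by positivity),
            Real.div_rpow hpos.le hb.le]
          field_simp
      _ ≤ _ := by gcongr

/-- Talagrand's exponential inequality for the convex distance to a compact set. -/
theorem lintegral_exp_sqDist_le (μ : Measure X) [IsProbabilityMeasure μ] (n : ℕ)
    (A : Set (Fin n → X)) (hA : IsCompact A) :
    ∫⁻ x, ENNReal.ofReal (Real.exp (sqDist x A / 4)) ∂Measure.pi (fun _ => μ) ≤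
      (Measure.pi (fun _ => μ) A)⁻¹ := by
  induction n with
  | zero =>
    have h0 : ∀ x, sqDist x A ≤ 0 := by
      intro x
      rcases Set.eq_empty_or_nonempty A with rfl | h
      -- For empty A the infimum is over the empty set, with default value 0.
      · simp [sqDist, separationSet]
      · obtain ⟨z, hz⟩ := separationSet_nonempty x h
        simpa using sqDist_le_of_mem (subset_convexHull ℝ _ hz)
    calc _ ≤ ∫⁻ _, 1 ∂Measure.pi (fun _ : Fin 0 => μ) := by
          refine lintegral_mono fun x => ?_
          rw [ENNReal.ofReal_le_one, Real.exp_le_one_iff]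
          linarith [h0 x]
      _ ≤ _ := by
          rw [lintegral_one, measure_univ]
          exact ENNReal.one_le_inv.2 prob_le_one
  | succ n ih =>
    set Q : Measure (Fin n → X) := Measure.pi fun _ => μ with hQ
    have hpres := map_cons_pi μ n
    have hAm := hA.measurableSet
    have hm := measurable_sqDist hA
    rcases eq_or_ne (Measure.pi (fun _ : Fin (n + 1) => μ) A) 0 with h0 | h0
    · simp [h0]
    have hne : A.Nonempty := nonempty_of_measure_ne_zero h0
    set a := (Measure.pi fun _ : Fin (n + 1) => μ).real A with ha
    have hapos : 0 < a := measureReal_nonneg.lt_of_ne' ((measureReal_ne_zero_iff).2 h0)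
    let c : X → ℝ := fun w => Q.real {y : Fin n → X | (Fin.cons w y : Fin (n + 1) → X) ∈ A}
    have hcm : Measurable c :=
      (measurable_measure_prodMk_left (hpres.measurable hAm)).ennreal_toReal
    have hca : ∫ w, c w ∂μ = a := by
      rw [ha, ← integral_indicator_one hAm, ← hpres.map_eq,
        integral_map hpres.measurable.aemeasurable
          (Measurable.aestronglyMeasurable (measurable_one.indicator hAm)), integral_prod]
      · refine integral_congr_ae (ae_of_all _ fun w => ?_)
        exact (integral_indicator_one ((measurable_prodMk_left (x := w))
          (hpres.measurable hAm))).symm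
      · refine Integrable.of_bound (C := 1) (Measurable.aestronglyMeasurable
          ((measurable_one.indicator hAm).comp hpres.measurable)) (ae_of_all _ fun p => ?_)
        by_cases h : (Fin.cons p.1 p.2 : Fin (n + 1) → X) ∈ A <;> simp [h]
    have hci : Integrable c μ := Integrable.of_bound (C := 1) hcm.aestronglyMeasurable
      (ae_of_all _ fun w => by
        rw [Real.norm_of_nonneg measureReal_nonneg]; exact measureReal_le_one)
    set b := Q.real (Fin.tail '' A) with hb
    have hcb : ∀ w, c w ≤ b := fun w => measureReal_mono fun y hy => ⟨_, hy, by simp⟩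
    have hab : a ≤ b := by
      rw [← hca]
      simpa using integral_mono hci (integrable_const b) hcb
    have hbpos : 0 < b := hapos.trans_le hab
    calc _ = ∫⁻ w, ∫⁻ x, ENNReal.ofReal (Real.exp
            (sqDist (Fin.cons w x : Fin (n + 1) → X) A / 4)) ∂Q ∂μ := by
          rw [← hpres.lintegral_comp (f := fun x => ENNReal.ofReal (Real.exp (sqDist x A / 4)))
            (by fun_prop), lintegral_prod]
          exact Measurable.aemeasurable (Measurable.comp
            (g := fun x => ENNReal.ofReal (Real.exp (sqDist x A / 4))) (by fun_prop)
            hpres.measurable)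
      _ ≤ ∫⁻ w, ENNReal.ofReal ((2 - c w / b) / b) ∂μ :=
          lintegral_mono fun w => lintegral_exp_sqDist_cons_le μ ih hA hne hbpos rfl w
      _ = ENNReal.ofReal ((2 - a / b) / b) := by
          have hi : Integrable (fun w => (2 - c w / b) / b) μ :=
            ((integrable_const 2).sub (hci.div_const b)).div_const b
          rw [← ofReal_integral_eq_lintegral_ofReal hi, integral_div, integral_sub
            (integrable_const 2) (hci.div_const b), integral_div, hca]
          · simp
          · refine ae_of_all _ fun w => ?_
            have : c w / b ≤ 1 := (div_le_one hbpos).2 (hcb w)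
            exact div_nonneg (by linarith) hbpos.le
      -- This is a/b + b/a ≥ 2.
      _ ≤ ENNReal.ofReal a⁻¹ := by
          refine ENNReal.ofReal_le_ofReal ?_
          rw [div_le_iff₀ hbpos, inv_mul_eq_div, ← sub_nonneg]
          have : b / a - (2 - a / b) = (b - a) ^ 2 / (a * b) := by
            field_simp
            ring
          rw [this]
          positivity
      _ = _ := by
          rw [ENNReal.ofReal_inv_of_pos hapos, ofReal_measureReal]

/-- Talagrand's concentration inequality for the convex distance. The set `D` of points at
distance at least `s` from `A` need not be measurable. -/
theorem measure_mul_measure_le (μ : Measure X) [IsProbabilityMeasure μ] {n : ℕ}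
    {A D : Set (Fin n → X)} (hA : MeasurableSet A) {s : ℝ} (hs : 0 ≤ s) [DecidableEq X]
    (hD : ∀ x ∈ D, ∃ a : Fin n → ℝ, (∀ i, 0 ≤ a i) ∧ ∑ i, a i ^ 2 ≤ 1 ∧
      ∀ y ∈ A, s ≤ ∑ i, if x i ≠ y i then a i else 0) :
    Measure.pi (fun _ => μ) A * Measure.pi (fun _ => μ) D ≤
      ENNReal.ofReal (Real.exp (-s ^ 2 / 4)) := by
  -- Inner regularity reduces to compact K ⊆ A; the separation hypothesis on `D` is inherited by K.
  rw [hA.measure_eq_iSup_isCompact_of_ne_top (measure_ne_top _ _), ENNReal.iSup_mul]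
  refine iSup_le fun K => ?_
  rw [ENNReal.iSup_mul]
  refine iSup_le fun hKA => ?_
  rw [ENNReal.iSup_mul]
  refine iSup_le fun hK => ?_
  rcases Set.eq_empty_or_nonempty K with rfl | hKne
  · simp
  have hm := measurable_sqDist hK
  have hDsub : D ⊆ {x | ENNReal.ofReal (Real.exp (s ^ 2 / 4)) ≤
      ENNReal.ofReal (Real.exp (sqDist x K / 4))} := by
    intro x hx
    obtain ⟨a, ha0, ha1, ha⟩ := hD x hx
    have := sq_le_sqDist hKne ha0 ha1 hs fun y hy => ha y (hKA hy)
    refine ENNReal.ofReal_le_ofReal (Real.exp_le_exp.2 ?_)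
    linarith
  have hmarkov := (mul_meas_ge_le_lintegral (μ := Measure.pi fun _ : Fin n => μ)
    (f := fun x => ENNReal.ofReal (Real.exp (sqDist x K / 4))) (by fun_prop)
    (ENNReal.ofReal (Real.exp (s ^ 2 / 4)))).trans (lintegral_exp_sqDist_le μ n K hK)
  set p := Measure.pi (fun _ : Fin n => μ) K
  have hp : p ≠ ⊤ := measure_ne_top _ _
  have h1 : ENNReal.ofReal (Real.exp (s ^ 2 / 4)) * Measure.pi (fun _ => μ) D ≤ p⁻¹ :=
    le_trans (by gcongr) hmarkov
  rw [neg_div, Real.exp_neg, ENNReal.ofReal_inv_of_pos (Real.exp_pos _)]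
  rw [ENNReal.le_inv_iff_mul_le] at h1 ⊢
  exact (le_of_eq (by ring)).trans h1

end Measure

end ConvexDistance

/-! ### Counting measures as images of tuples -/

namespace FiniteCountingMeasure

variable {E : Type*} [MeasurableSpace E]

/-- The unit mass at a point of `E`, and no mass for the additional point of `E ⊕ Unit`. -/
def pointMass : E ⊕ Unit → Measure E := Sum.elim Measure.dirac fun _ => 0

@[simp] lemma pointMass_inl (x : E) : pointMass (Sum.inl x) = Measure.dirac x := rfl

@[simp] lemma pointMass_inr (u : Unit) : pointMass (Sum.inr u : E ⊕ Unit) = 0 := rfl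

lemma exists_sum_pointMass_eq {n : ℕ} (y : Fin n → E ⊕ Unit) :
    ∃ (k : ℕ) (x : Fin k → E), ∑ i, pointMass (y i) = ∑ i, Measure.dirac (x i) := by
  induction n with
  | zero => exact ⟨0, Fin.elim0, by simp⟩
  | succ n ih =>
    obtain ⟨k, x, hx⟩ := ih (Fin.tail y)
    simp only [Fin.tail] at hx
    rw [Fin.sum_univ_succ, hx]
    cases y 0 with
    | inl a => exact ⟨k + 1, Fin.cons a x, by simp [Fin.sum_univ_succ]⟩
    | inr u => exact ⟨k, x, by simp⟩

/-- The counting measure of a tuple of points of `E`, some of which may be absent. -/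
def ofPoints {n : ℕ} (y : Fin n → E ⊕ Unit) : FiniteCountingMeasure E :=
  ⟨∑ i, pointMass (y i), exists_sum_pointMass_eq y⟩

lemma toMeasure_ofPoints {n : ℕ} (y : Fin n → E ⊕ Unit) :
    (ofPoints y).toMeasure = ∑ i, pointMass (y i) := rfl

lemma measurable_toMeasure : Measurable (toMeasure : FiniteCountingMeasure E → Measure E) :=
  comap_measurable _

lemma measurable_toMeasure_apply {B : Set E} (hB : MeasurableSet B) :
    Measurable fun ξ : FiniteCountingMeasure E => ξ.toMeasure B :=
  (Measure.measurable_coe hB).comp measurable_toMeasure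

lemma measurable_pointMass : Measurable (pointMass : E ⊕ Unit → Measure E) :=
  Measure.measurable_dirac.sumElim measurable_const

lemma measurable_ofPoints (n : ℕ) :
    Measurable (ofPoints : (Fin n → E ⊕ Unit) → FiniteCountingMeasure E) := by
  refine measurable_comap_iff.2 (Measure.measurable_of_measurable_coe _ fun B hB => ?_)
  simp only [Function.comp_apply, toMeasure_ofPoints, Measure.finsetSum_apply]
  exact Finset.measurable_sum _ fun i _ =>
    (Measure.measurable_coe hB).comp (measurable_pointMass.comp (measurable_pi_apply i))

lemma lintegral_ofPoints [MeasurableSingletonClass E] {n : ℕ} (y : Fin n → E ⊕ Unit)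
    (f : E → ℝ≥0∞) :
    ∫⁻ x, f x ∂(ofPoints y).toMeasure = ∑ i, Sum.elim f (fun _ => 0) (y i) := by
  rw [toMeasure_ofPoints, lintegral_finsetSum_measure]
  refine Finset.sum_congr rfl fun i _ => ?_
  cases y i <;> simp

lemma ofPoints_apply {n : ℕ} (y : Fin n → E ⊕ Unit) {B : Set E} (hB : MeasurableSet B)
    [DecidablePred fun i => y i ∈ Sum.inl '' B] :
    (ofPoints y).toMeasure B = (Finset.univ.filter fun i => y i ∈ Sum.inl '' B).card := by
  rw [toMeasure_ofPoints, Measure.finsetSum_apply, Finset.card_filter, Nat.cast_sum]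
  refine Finset.sum_congr rfl fun i _ => ?_
  obtain ⟨a, hi⟩ | ⟨u, hi⟩ : (∃ a, y i = Sum.inl a) ∨ ∃ u, y i = Sum.inr u := by
    cases y i <;> simp
  · by_cases h : a ∈ B <;> simp [hB, h, hi]
  · simp [hi]

lemma exists_ofPoints_eq {n : ℕ} {ξ : FiniteCountingMeasure E} (h : ξ.toMeasure Set.univ ≤ n) :
    ∃ y : Fin n → E ⊕ Unit, ofPoints y = ξ := by
  obtain ⟨_, k, x, rfl⟩ := ξ
  have hk : k ≤ n := by simpa [toMeasure] using h
  obtain ⟨m, rfl⟩ := Nat.exists_eq_add_of_le hk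
  refine ⟨Fin.append (fun i => Sum.inl (x i)) fun _ => Sum.inr (), Subtype.ext ?_⟩
  simp [ofPoints, Fin.sum_univ_add]

/-- Changing `ν` into `ξ` costs at least as much on the tuples of points as on the counting
measures. -/
lemma lintegral_diff_ofPoints_le [MeasurableSingletonClass E] [DecidableEq (E ⊕ Unit)] {n : ℕ}
    (y z : Fin n → E ⊕ Unit) (f : E → ℝ≥0∞) :
    ∫⁻ x, f x ∂((ofPoints y).diff (ofPoints z)) ≤
      ∑ i, if y i ≠ z i then Sum.elim f (fun _ => 0) (y i) else 0 := by
  -- Indices where y and z agree contribute equally to both multiplicities and cancel.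
  have hle : ∀ x : E, (ofPoints y).toMeasure {x} - (ofPoints z).toMeasure {x} ≤
      ∑ i, if y i ≠ z i then pointMass (y i) {x} else 0 := by
    intro x
    rw [tsub_le_iff_right, toMeasure_ofPoints, toMeasure_ofPoints, Measure.finsetSum_apply,
      Measure.finsetSum_apply, ← Finset.sum_add_distrib]
    refine Finset.sum_le_sum fun i _ => ?_
    by_cases h : y i = z i <;> simp [h]
  rw [diff, lintegral_sum_measure]
  calc _ = ∑' x : {x : E // 0 < (ofPoints y).toMeasure {x}},
        ((ofPoints y).toMeasure {x.1} - (ofPoints z).toMeasure {x.1}) * f x := by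
        simp [lintegral_smul_measure]
    _ ≤ ∑' x : {x : E // 0 < (ofPoints y).toMeasure {x}},
        (∑ i, if y i ≠ z i then pointMass (y i) {x.1} else 0) * f x := by
        gcongr
        exact hle _
    _ ≤ ∑' x : E, (∑ i, if y i ≠ z i then pointMass (y i) {x} else 0) * f x :=
        ENNReal.tsum_comp_le_tsum_of_injective Subtype.val_injective
          fun x => (∑ i, if y i ≠ z i then pointMass (y i) {x} else 0) * f x
    _ = ∑ i, ∑' x : E, (if y i ≠ z i then pointMass (y i) {x} else 0) * f x := by
        simp_rw [Finset.sum_mul]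
        exact Summable.tsum_finsetSum fun i _ => ENNReal.summable
    _ ≤ _ := by
        refine Finset.sum_le_sum fun i _ => ?_
        split_ifs with h
        · cases y i with
          | inl a =>
            rw [tsum_eq_single a fun x hx => by simp [hx.symm]]
            simp
          | inr u => simp
        · simp

/-- A function α witnessing distance greater than s gives the weights α(y i), with weight 0 on
absent points. -/
lemma exists_weights [MeasurableSingletonClass E] [DecidableEq (E ⊕ Unit)] {n : ℕ}
    {y : Fin n → E ⊕ Unit} {A : Set (FiniteCountingMeasure E)} {s : ℝ}
    (hy : ofPoints y ∉ parallelSet A s) :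
    ∃ a : Fin n → ℝ, (∀ i, 0 ≤ a i) ∧ ∑ i, a i ^ 2 ≤ 1 ∧
      ∀ z, ofPoints z ∈ A → s ≤ ∑ i, if y i ≠ z i then a i else 0 := by
  simp only [parallelSet, Set.mem_ofPred_eq, not_le, convexDist, lt_iSup_iff] at hy
  obtain ⟨α, hα, h⟩ := hy
  let a : Fin n → ℝ≥0 := fun i => Sum.elim α (fun _ => 0) (y i)
  have ha : ∀ i, Sum.elim (fun x => (α x : ℝ≥0∞)) (fun _ => 0) (y i) = a i := by
    intro i
    simp only [a]
    cases y i <;> simp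
  refine ⟨fun i => a i, fun i => (a i).2, ?_, fun z hz => ?_⟩
  · rw [lintegral_ofPoints] at hα
    have h2 : ∀ i, Sum.elim (fun x => (α x : ℝ≥0∞) ^ 2) (fun _ => 0) (y i) =
        ((a i ^ 2 : ℝ≥0) : ℝ≥0∞) := by
      intro i
      simp only [a]
      cases y i <;> simp
    simp only [h2] at hα
    beta_reduce
    exact_mod_cast hα
  · have h1 := h.le.trans ((iInf₂_le (ofPoints z) hz).trans (lintegral_diff_ofPoints_le y z _))
    simp only [ha] at h1
    have h2 : (∑ i, if y i ≠ z i then (a i : ℝ≥0∞) else 0) =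
        ENNReal.ofReal (∑ i, if y i ≠ z i then (a i : ℝ) else 0) := by
      rw [ENNReal.ofReal_sum_of_nonneg fun i _ => by split_ifs <;> positivity]
      refine Finset.sum_congr rfl fun i _ => ?_
      split_ifs <;> simp
    rw [h2] at h1
    exact (ENNReal.ofReal_le_ofReal_iff (Finset.sum_nonneg fun i _ => by
      split_ifs <;> positivity)).1 h1

end FiniteCountingMeasure

/-! ### Standard Borel structure of the point space -/

/-- A locally compact second countable Hausdorff space is Polish: it is open in its completion for
any compatible metric. -/
lemma polishSpace_of_locallyCompact (E : Type*) [TopologicalSpace E] [LocallyCompactSpace E]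
    [SecondCountableTopology E] [T2Space E] : PolishSpace E := by
  let := TopologicalSpace.metrizableSpaceMetric E
  have hdense : DenseRange ((↑) : E → UniformSpace.Completion E) :=
    UniformSpace.Completion.denseRange_coe
  have hind : Topology.IsEmbedding ((↑) : E → UniformSpace.Completion E) :=
    (UniformSpace.Completion.isUniformEmbedding_coe E).isEmbedding
  have hopen : IsOpen (Set.range ((↑) : E → UniformSpace.Completion E)) := by
    rw [isOpen_iff_mem_nhds]
    rintro _ ⟨x, rfl⟩
    obtain ⟨K, hK, hxK⟩ := exists_compact_mem_nhds x
    rw [hind.isInducing.nhds_eq_comap, Filter.mem_comap] at hxK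
    obtain ⟨V, hV, hVK⟩ := hxK
    obtain ⟨U, hUV, hU, hxU⟩ := mem_nhds_iff.1 hV
    refine Filter.mem_of_superset (hU.mem_nhds hxU) fun z hz => ?_
    have hKc : IsClosed (((↑) : E → UniformSpace.Completion E) '' K) :=
      (hK.image (UniformSpace.Completion.continuous_coe E)).isClosed
    have hz' : z ∈ closure (U ∩ Set.range ((↑) : E → UniformSpace.Completion E)) :=
      hdense.open_subset_closure_inter hU hz
    have hsub : U ∩ Set.range ((↑) : E → UniformSpace.Completion E) ⊆
        ((↑) : E → UniformSpace.Completion E) '' K := by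
      rintro _ ⟨hu, v, rfl⟩
      exact ⟨v, hVK (hUV hu), rfl⟩
    obtain ⟨v, -, rfl⟩ := closure_minimal hsub hKc hz'
    exact ⟨v, rfl⟩
  have := hopen.polishSpace
  exact (hind.toHomeomorph.isClosedEmbedding).polishSpace

instance Sum.instBorelSpace {α β : Type*} [TopologicalSpace α] [TopologicalSpace β]
    [MeasurableSpace α] [MeasurableSpace β] [BorelSpace α] [BorelSpace β] :
    BorelSpace (α ⊕ β) := by
  have h : OpensMeasurableSpace (α ⊕ β) := by
    refine ⟨MeasurableSpace.generateFrom_le fun s hs => ?_⟩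
    exact measurableSet_sum_iff.2 ⟨(hs.preimage continuous_inl).measurableSet,
      (hs.preimage continuous_inr).measurableSet⟩
  refine ⟨le_antisymm (fun s hs => ?_) h.borel_le⟩
  obtain ⟨h1, h2⟩ := measurableSet_sum_iff.1 hs
  let : MeasurableSpace (α ⊕ β) := borel _
  have : BorelSpace (α ⊕ β) := ⟨rfl⟩
  rw [← Set.image_preimage_inl_union_image_preimage_inr s]
  exact (Topology.IsOpenEmbedding.inl.measurableEmbedding.measurableSet_image.2 h1).union
    (Topology.IsOpenEmbedding.inr.measurableEmbedding.measurableSet_image.2 h2)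

instance StandardBorelSpace.sum {α β : Type*} [MeasurableSpace α] [MeasurableSpace β]
    [StandardBorelSpace α] [StandardBorelSpace β] : StandardBorelSpace (α ⊕ β) :=
  letI := upgradeStandardBorel α
  letI := upgradeStandardBorel β
  inferInstance

/-! ### Symmetric sets and outer measure under `ofPoints` -/

namespace FiniteCountingMeasure

variable {E : Type*} [MeasurableSpace E]

/-- The counting measure does not see absent points, but n is known: if C contains the additional
point, count the complement instead. -/
lemma measurableSet_comap_lt_card {n : ℕ} {C : Set (E ⊕ Unit)} (hC : MeasurableSet C)
    [DecidablePred (· ∈ C)] (j : Fin n) :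
    MeasurableSet[MeasurableSpace.comap ofPoints inferInstance]
      {y : Fin n → E ⊕ Unit | (j : ℕ) < (Finset.univ.filter fun i => y i ∈ C).card} := by
  classical
  have hB : MeasurableSet (Sum.inl ⁻¹' C : Set E) := measurable_inl hC
  by_cases h : Sum.inr () ∈ C
  · refine ⟨{ξ | ξ.toMeasure (Sum.inl ⁻¹' C)ᶜ < (n - j : ℕ)},
      measurable_toMeasure_apply hB.compl measurableSet_Iio, ?_⟩
    ext y
    have hcard := Finset.card_filter_add_card_filter_not (s := Finset.univ) fun i => y i ∈ C
    have hcompl : (Finset.univ.filter fun i => y i ∉ C) =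
        Finset.univ.filter fun i => y i ∈ Sum.inl '' (Sum.inl ⁻¹' C)ᶜ := by
      ext i
      rcases hi : y i with a | u <;> simp [h, hi]
    rw [hcompl, Finset.card_fin] at hcard
    simp only [Set.mem_preimage, Set.mem_ofPred_eq, ofPoints_apply y hB.compl, Nat.cast_lt]
    omega
  · refine ⟨{ξ | (j : ℕ) < ξ.toMeasure (Sum.inl ⁻¹' C)},
      measurable_toMeasure_apply hB measurableSet_Ioi, ?_⟩
    ext y
    have heq : (Finset.univ.filter fun i => y i ∈ C) =
        Finset.univ.filter fun i => y i ∈ Sum.inl '' (Sum.inl ⁻¹' C) := by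
      ext i
      rcases hi : y i with a | u <;> simp [h, hi]
    simp only [Set.mem_preimage, Set.mem_ofPred_eq, ofPoints_apply y hB, Nat.cast_lt, heq]

/-- A measurable set of tuples that is invariant under permutations is determined by the counting
measure of the tuple, in a measurable way. -/
lemma measurableSet_comap_ofPoints [StandardBorelSpace E] {n : ℕ} {S : Set (Fin n → E ⊕ Unit)}
    (hS : MeasurableSet S) (hsymm : ∀ (σ : Equiv.Perm (Fin n)) (y), y ∘ σ ∈ S ↔ y ∈ S) :
    MeasurableSet[MeasurableSpace.comap ofPoints inferInstance] S := by
  classical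
  obtain ⟨e, he⟩ := exists_measurableEmbedding_real (E ⊕ Unit)
  obtain ⟨R, hR, rfl⟩ : MeasurableSet[MeasurableSpace.comap
      (fun (y : Fin n → E ⊕ Unit) i => e (y i)) MeasurableSpace.pi] S := by
    convert hS
    simp only [MeasurableSpace.pi, MeasurableSpace.comap_iSup, MeasurableSpace.comap_comp]
    refine iSup_congr fun i => ?_
    rw [← he.comap_eq, MeasurableSpace.comap_comp]
    rfl
  -- The order statistics are functions of the counting measure: the j-th (from 0) is at most t iff
  -- more than j entries are. By symmetry, a tuple lies in the set iff its sorted version does.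
  let sorted : (Fin n → E ⊕ Unit) → Fin n → ℝ :=
    fun y => (fun i => e (y i)) ∘ Tuple.sort fun i => e (y i)
  have hsorted : Measurable[MeasurableSpace.comap ofPoints inferInstance] sorted := by
    refine @measurable_pi_lambda _ _ _ (MeasurableSpace.comap ofPoints inferInstance) _ _
      fun j => ?_
    refine @measurable_of_Iic _ _ _ _ _ (MeasurableSpace.comap ofPoints inferInstance) _ _ _ _
      fun t => ?_
    convert measurableSet_comap_lt_card (he.measurable (measurableSet_Iic (a := t))) j using 1
    ext y
    simp only [Set.mem_preimage, Set.mem_Iic, Set.mem_ofPred_eq, sorted]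
    rw [← Tuple.lt_card_le_iff_apply_le_of_monotone
      (Tuple.monotone_sort fun i => e (y i))]
    rw [← Finset.card_map (Tuple.sort fun i => e (y i)).toEmbedding]
    congr! 2
    ext i
    simp
  convert hsorted hR using 1
  ext y
  exact (hsymm (Tuple.sort fun i => e (y i)) y).symm

/-- Passing to the law of the counting measure does not increase the outer measure of a set. -/
lemma map_ofPoints_apply_le [StandardBorelSpace E] {n : ℕ} (ν : Measure (E ⊕ Unit))
    [IsProbabilityMeasure ν] (D : Set (FiniteCountingMeasure E)) :
    (Measure.pi fun _ : Fin n => ν).map ofPoints D ≤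
      Measure.pi (fun _ : Fin n => ν) (ofPoints ⁻¹' D) := by
  set Q := Measure.pi fun _ : Fin n => ν
  -- Intersecting the measurable hull over all permutations makes it symmetric, and it still
  -- contains the already symmetric preimage of D.
  let S : Set (Fin n → E ⊕ Unit) :=
    ⋂ σ : Equiv.Perm (Fin n), (fun y => y ∘ σ) ⁻¹' toMeasurable Q (ofPoints ⁻¹' D)
  have hperm : ∀ (σ : Equiv.Perm (Fin n)) (y : Fin n → E ⊕ Unit),
      ofPoints (y ∘ σ) = ofPoints y := fun σ y =>
    Subtype.ext (Equiv.sum_comp σ fun i => pointMass (y i))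
  have hS : MeasurableSet S := MeasurableSet.iInter fun σ =>
    (measurable_pi_lambda _ fun i => measurable_pi_apply (σ i)) (measurableSet_toMeasurable _ _)
  have hsymm : ∀ (σ : Equiv.Perm (Fin n)) (y), y ∘ σ ∈ S ↔ y ∈ S := by
    intro σ y
    simp only [S, Set.mem_iInter, Set.mem_preimage, Function.comp_assoc, ← Equiv.Perm.coe_mul]
    exact ⟨fun h τ => by simpa using h (σ⁻¹ * τ), fun h τ => h (σ * τ)⟩
  have hDS : ofPoints ⁻¹' D ⊆ S := by
    intro y hy
    simp only [S, Set.mem_iInter]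
    exact fun σ => subset_toMeasurable _ _ (by simpa [hperm] using hy)
  have hSD : S ⊆ toMeasurable Q (ofPoints ⁻¹' D) := fun y hy => by
    simpa using Set.mem_iInter.1 hy 1
  obtain ⟨R, hR, hRS⟩ := measurableSet_comap_ofPoints hS hsymm
  have hbig : MeasurableSet {ξ : FiniteCountingMeasure E | (n : ℝ≥0∞) < ξ.toMeasure Set.univ} :=
    measurable_toMeasure_apply MeasurableSet.univ measurableSet_Ioi
  -- `R` is controlled only on the range of `ofPoints`; measures of mass above n lie outside it and
  -- have empty preimage.
  calc _ ≤ Q.map ofPoints (R ∪ {ξ | (n : ℝ≥0∞) < ξ.toMeasure Set.univ}) := by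
        refine measure_mono fun ξ hξ => ?_
        by_cases h : ξ.toMeasure Set.univ ≤ n
        · obtain ⟨y, rfl⟩ := exists_ofPoints_eq h
          refine Or.inl ?_
          change y ∈ ofPoints ⁻¹' R
          rw [hRS]
          exact hDS hξ
        · exact Or.inr (not_le.1 h)
    _ = Q (ofPoints ⁻¹' (R ∪ {ξ | (n : ℝ≥0∞) < ξ.toMeasure Set.univ})) :=
        Measure.map_apply (measurable_ofPoints n) (hR.union hbig)
    _ ≤ Q (toMeasurable Q (ofPoints ⁻¹' D)) := by
        refine measure_mono ?_
        rintro y (hy | hy)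
        · rw [← Set.mem_preimage, hRS] at hy
          exact hSD hy
        · classical
          have h1 := Finset.card_le_univ
            (Finset.univ.filter fun i => y i ∈ Sum.inl '' (Set.univ : Set E))
          rw [Fintype.card_fin] at h1
          simp only [Set.mem_ofPred_eq, ofPoints_apply y MeasurableSet.univ, Nat.cast_lt] at hy
          exact absurd hy (not_lt.2 h1)
    _ = _ := measure_toMeasurable _

/-- The concentration inequality for the counting measure of independent points. -/
theorem map_ofPoints_mul_le [StandardBorelSpace E] {n : ℕ} (ν : Measure (E ⊕ Unit))
    [IsProbabilityMeasure ν] {A : Set (FiniteCountingMeasure E)} (hA : MeasurableSet A) {s : ℝ}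
    (hs : 0 ≤ s) :
    (Measure.pi fun _ : Fin n => ν).map ofPoints A *
      (Measure.pi fun _ : Fin n => ν).map ofPoints (parallelSet A s)ᶜ ≤
      ENNReal.ofReal (Real.exp (-s ^ 2 / 4)) := by
  classical
  let := upgradeStandardBorel (E ⊕ Unit)
  refine le_trans (mul_le_mul' (Measure.map_apply (measurable_ofPoints n) hA).le
    (map_ofPoints_apply_le ν _)) ?_
  exact ConvexDistance.measure_mul_measure_le ν (measurable_ofPoints n hA) hs
    fun y hy => exists_weights hy

end FiniteCountingMeasure

/-! ### Characteristic functionals -/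

namespace FiniteCountingMeasure

variable {E : Type*} [MeasurableSpace E]

instance instIsFiniteMeasure (ξ : FiniteCountingMeasure E) : IsFiniteMeasure ξ.toMeasure := by
  obtain ⟨_, k, x, rfl⟩ := ξ
  exact inferInstanceAs (IsFiniteMeasure (∑ i, Measure.dirac (x i)))

lemma integral_simpleFunc (f : SimpleFunc E ℝ) (ξ : FiniteCountingMeasure E) :
    ∫ x, f x ∂ξ.toMeasure = ∑ c ∈ f.range, ξ.toMeasure.real (f ⁻¹' {c}) * c := by
  rw [← SimpleFunc.integral_eq_integral f (SimpleFunc.integrable_of_isFiniteMeasure f),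
    SimpleFunc.integral_eq]
  rfl

lemma measurable_toMeasure_real {B : Set E} (hB : MeasurableSet B) :
    Measurable fun ξ : FiniteCountingMeasure E => ξ.toMeasure.real B :=
  (measurable_toMeasure_apply hB).ennreal_toReal

lemma measurable_integral_simpleFunc (f : SimpleFunc E ℝ) :
    Measurable fun ξ : FiniteCountingMeasure E => ∫ x, f x ∂ξ.toMeasure := by
  simp_rw [integral_simpleFunc]
  exact Finset.measurable_sum _ fun c _ =>
    (measurable_toMeasure_real (f.measurableSet_fiber c)).mul_const c

/-- The characteristic functional `∫ exp(i ∫ f dξ) Q(dξ)` of a law on finite counting measures. -/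
def charFunctional (Q : Measure (FiniteCountingMeasure E)) (f : SimpleFunc E ℝ) : ℂ :=
  ∫ ξ, Complex.exp ((∫ x, f x ∂ξ.toMeasure : ℝ) * Complex.I) ∂Q

lemma measurable_exp_integral (f : SimpleFunc E ℝ) :
    Measurable fun ξ : FiniteCountingMeasure E =>
      Complex.exp ((∫ x, f x ∂ξ.toMeasure : ℝ) * Complex.I) := by
  have := measurable_integral_simpleFunc f
  fun_prop

lemma integrable_exp_integral (Q : Measure (FiniteCountingMeasure E)) [IsFiniteMeasure Q]
    (f : SimpleFunc E ℝ) :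
    Integrable (fun ξ : FiniteCountingMeasure E =>
      Complex.exp ((∫ x, f x ∂ξ.toMeasure : ℝ) * Complex.I)) Q :=
  Integrable.of_bound (C := 1) (measurable_exp_integral f).aestronglyMeasurable
    (ae_of_all _ fun _ => (Complex.norm_exp_ofReal_mul_I _).le)

lemma measurableSpace_eq_comap_real :
    (instMeasurableSpace : MeasurableSpace (FiniteCountingMeasure E)) =
      MeasurableSpace.comap
        (fun ξ (B : {B : Set E // MeasurableSet B}) => ξ.toMeasure.real B.1)
        MeasurableSpace.pi := by
  refine le_antisymm ?_ ?_
  · refine Measurable.comap_le ?_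
    refine @Measure.measurable_of_measurable_coe _ _ _ (_) _ fun B hB => ?_
    have h : (fun ξ : FiniteCountingMeasure E => ξ.toMeasure B) =
        (fun v : {B : Set E // MeasurableSet B} → ℝ => ENNReal.ofReal (v ⟨B, hB⟩)) ∘
        fun ξ B => ξ.toMeasure.real B.1 := by
      ext ξ
      simp
    rw [h]
    exact (ENNReal.measurable_ofReal.comp (measurable_pi_apply _)).comp (comap_measurable _)
  · exact (measurable_pi_lambda _ fun B => measurable_toMeasure_real B.2).comap_le

/-- A law on finite counting measures is determined by its characteristic functional. -/
theorem ext_of_charFunctional {Q₁ Q₂ : Measure (FiniteCountingMeasure E)} [IsFiniteMeasure Q₁]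
    [IsFiniteMeasure Q₂] (h : ∀ f, charFunctional Q₁ f = charFunctional Q₂ f) : Q₁ = Q₂ := by
  classical
  let Φ : FiniteCountingMeasure E → {B : Set E // MeasurableSet B} → ℝ :=
    fun ξ B => ξ.toMeasure.real B.1
  have hΦ : Measurable Φ := measurable_pi_lambda _ fun B => measurable_toMeasure_real B.2
  have hmap : Q₁.map Φ = Q₂.map Φ := by
    refine IsProjectiveLimit.unique (P := fun I => (Q₂.map Φ).map I.restrict) (fun I => ?_)
      fun I => rfl
    have hI : Measurable (I.restrict : ({B : Set E // MeasurableSet B} → ℝ) → I → ℝ) :=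
      Finset.measurable_restrict I
    refine Measure.ext_of_charFunDual (funext fun L => ?_)
    -- A linear functional of the masses ξ(B), B ∈ I, is the integral of a simple function. Its
    -- value at x depends only on which B contain x, hence the finite range.
    let g : (I → Prop) → ℝ := fun p => ∑ B : I, if p B then L (Pi.single B 1) else 0
    let f : SimpleFunc E ℝ :=
      { toFun := fun x => ∑ B : I, B.1.1.indicator (fun _ => L (Pi.single B 1)) x
        measurableSet_fiber' := fun c => (Finset.measurable_sum _ fun (B : I) _ =>
          measurable_const.indicator B.1.2) (measurableSet_singleton c)
        finite_range' := by
          refine (Set.finite_range g).subset ?_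
          rintro _ ⟨x, rfl⟩
          exact ⟨fun B => x ∈ B.1.1, rfl⟩ }
    have hL : ∀ ξ, L (I.restrict (Φ ξ)) = ∫ x, f x ∂ξ.toMeasure := by
      intro ξ
      have h1 : ∫ x, f x ∂ξ.toMeasure =
          ∑ B : I, ∫ x, B.1.1.indicator (fun _ => L (Pi.single B 1)) x ∂ξ.toMeasure :=
        integral_finsetSum _ fun B _ => (integrable_const _).indicator B.1.2
      rw [h1, ← ContinuousLinearMap.coe_coe, LinearMap.pi_apply_eq_sum_univ]
      refine Finset.sum_congr rfl fun B _ => ?_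
      rw [integral_indicator_const _ B.1.2]
      have h2 : (Pi.single B 1 : I → ℝ) = fun j => if B = j then 1 else 0 := by
        ext j
        simp [Pi.single_apply, eq_comm]
      rw [h2]
      rfl
    simp only [charFunDual_apply]
    rw [integral_map hI.aemeasurable (by fun_prop), integral_map hΦ.aemeasurable (by fun_prop),
      integral_map hI.aemeasurable (by fun_prop), integral_map hΦ.aemeasurable (by fun_prop)]
    simp only [hL]
    exact h f
  ext S hS
  rw [measurableSpace_eq_comap_real] at hS
  obtain ⟨R, hR, rfl⟩ := hS
  have := congrArg (fun μ => μ R) hmap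
  simpa only [Measure.map_apply hΦ hR] using this

lemma charFunctional_smul (c : ℝ) (hc : 0 ≤ c) (Q : Measure (FiniteCountingMeasure E))
    (f : SimpleFunc E ℝ) :
    charFunctional (ENNReal.ofReal c • Q) f = c * charFunctional Q f := by
  simp [charFunctional, integral_smul_measure, ENNReal.toReal_ofReal hc]

lemma integral_ofPoints [MeasurableSingletonClass E] {n : ℕ} (y : Fin n → E ⊕ Unit)
    (f : SimpleFunc E ℝ) :
    ∫ x, f x ∂(ofPoints y).toMeasure = ∑ i, Sum.elim f (fun _ => 0) (y i) := by
  have hi : ∀ i, Integrable f (pointMass (y i)) := by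
    intro i
    cases y i with
    | inl a => exact SimpleFunc.integrable_of_isFiniteMeasure (μ := Measure.dirac a) f
    | inr u => exact integrable_zero_measure
  rw [toMeasure_ofPoints, integral_finsetSum_measure fun i _ => hi i]
  refine Finset.sum_congr rfl fun i _ => ?_
  cases y i <;> simp

lemma charFunctional_map_ofPoints [MeasurableSingletonClass E] (n : ℕ) (ν : Measure (E ⊕ Unit))
    [IsProbabilityMeasure ν] (f : SimpleFunc E ℝ) :
    charFunctional ((Measure.pi fun _ : Fin n => ν).map ofPoints) f =
      (∫ y, Complex.exp ((Sum.elim f (fun _ => 0) y : ℝ) * Complex.I) ∂ν) ^ n := by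
  rw [charFunctional, integral_map (measurable_ofPoints n).aemeasurable
    (measurable_exp_integral f).aestronglyMeasurable]
  simp only [integral_ofPoints, Complex.ofReal_sum, Finset.sum_mul, Complex.exp_sum]
  rw [integral_fintype_prod_eq_pow (fun y => Complex.exp ((Sum.elim f (fun _ => 0) y : ℝ) *
    Complex.I)), Fintype.card_fin]

/-- The characteristic functional of a Poisson process. -/
theorem charFunctional_poisson {Ω : Type*} [MeasurableSpace Ω] {P : Measure Ω}
    [IsProbabilityMeasure P] {Λ : Measure E} [IsFiniteMeasure Λ]
    {η : Ω → FiniteCountingMeasure E} (hη : IsPoissonProcess η Λ P) (f : SimpleFunc E ℝ) :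
    charFunctional (P.map η) f =
      Complex.exp (∫ x, (Complex.exp (f x * Complex.I) - 1) ∂Λ) := by
  -- The fibres of f are disjoint, so ∫ f dη is a linear combination of independent Poisson
  -- variables.
  let e := f.range.equivFin
  let c : Fin f.range.card → ℝ := fun i => (e.symm i).1
  let B : Fin f.range.card → Set E := fun i => f ⁻¹' {c i}
  have hB : ∀ i, MeasurableSet (B i) := fun i => f.measurableSet_fiber _
  have hdisj : Pairwise fun i j => Disjoint (B i) (B j) := by
    intro i j hij
    refine Disjoint.preimage _ (Set.disjoint_singleton.2 fun h => hij ?_)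
    exact e.symm.injective (Subtype.ext h)
  have hsum : ∀ {M : Type} [AddCommMonoid M] (g : ℝ → M),
      ∑ x ∈ f.range, g x = ∑ i, g (c i) := by
    intro M _ g
    rw [← Finset.sum_coe_sort, ← e.symm.sum_comp]
  have hX : ∀ i, Measurable fun ω => (η ω).toMeasure (B i) := fun i =>
    (measurable_toMeasure_apply (hB i)).comp hη.measurable
  have hone : ∀ i, ∫ ω, Complex.exp (((η ω).toMeasure (B i)).toReal * c i * Complex.I) ∂P =
      Complex.exp (Λ.real (B i) * (Complex.exp (c i * Complex.I) - 1)) := by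
    intro i
    rw [← integral_map (f := fun v : ℝ≥0∞ => Complex.exp (v.toReal * c i * Complex.I))
      (hX i).aemeasurable (Measurable.aestronglyMeasurable (by fun_prop)), hη.map_eq _ (hB i),
      integral_map (by fun_prop) (Measurable.aestronglyMeasurable (by fun_prop))]
    have := charFun_map_cast_poissonMeasure (Λ (B i)).toNNReal (c i)
    rw [charFun_apply, integral_map .of_discrete (by fun_prop)] at this
    have h2 : (((Λ (B i)).toNNReal : ℝ) : ℂ) = Λ.real (B i) := rfl
    rw [← h2]
    convert this using 3
    simp [mul_comm]
  rw [charFunctional, integral_map hη.measurable.aemeasurable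
    (measurable_exp_integral f).aestronglyMeasurable]
  simp only [integral_simpleFunc, hsum, Complex.ofReal_sum, Finset.sum_mul, Complex.exp_sum,
    Complex.ofReal_mul]
  have hind := (hη.iIndepFun _ B hB hdisj).integral_fun_prod_comp (𝕜 := ℂ)
    (f := fun i v => Complex.exp (v.toReal * c i * Complex.I))
    (fun i => (hX i).aemeasurable) fun i => Measurable.aestronglyMeasurable (by fun_prop)
  refine hind.trans ?_
  simp only [hone, ← Complex.exp_sum]
  congr 1
  have hint : ∫ x, (Complex.exp (f x * Complex.I) - 1) ∂Λ =
      (f.map fun t : ℝ => Complex.exp (t * Complex.I) - 1).integral Λ := by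
    rw [SimpleFunc.integral_eq_integral _ (SimpleFunc.integrable_of_isFiniteMeasure _)]
    rfl
  rw [hint, SimpleFunc.map_integral f _ (SimpleFunc.integrable_of_isFiniteMeasure f) (by simp),
    hsum]
  simp [B]

end FiniteCountingMeasure

/-! ### Binomial and Poisson mixtures, and the limit -/

namespace FiniteCountingMeasure

open Filter Topology

variable {E : Type*} [MeasurableSpace E]

lemma integrable_exp_elim (ν : Measure (E ⊕ Unit)) [IsFiniteMeasure ν] (f : SimpleFunc E ℝ) :
    Integrable (fun y : E ⊕ Unit =>
      Complex.exp ((Sum.elim f (fun _ => 0) y : ℝ) * Complex.I)) ν := by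
  have : Measurable (Sum.elim f (fun _ => 0) : E ⊕ Unit → ℝ) :=
    f.measurable.sumElim measurable_const
  exact Integrable.of_bound (C := 1) (Measurable.aestronglyMeasurable (by fun_prop))
    (ae_of_all _ fun _ => (Complex.norm_exp_ofReal_mul_I _).le)

/-- The law on `E ⊕ Unit` that is proportional to `Λ` on `E` and to `1` at the additional
point. -/
def pointLaw (Λ : Measure E) : Measure (E ⊕ Unit) :=
  ENNReal.ofReal (Λ.real Set.univ + 1)⁻¹ • (Λ.map Sum.inl + Measure.dirac (Sum.inr ()))

instance instIsProbabilityMeasurePointLaw (Λ : Measure E) [IsFiniteMeasure Λ] :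
    IsProbabilityMeasure (pointLaw Λ) := by
  have hpos : 0 < Λ.real Set.univ + 1 := by positivity
  refine ⟨?_⟩
  rw [pointLaw, Measure.smul_apply, Measure.add_apply, Measure.map_apply measurable_inl .univ,
    Set.preimage_univ, measure_univ (μ := Measure.dirac _), smul_eq_mul,
    ← ofReal_measureReal (μ := Λ), ← ENNReal.ofReal_one,
    ← ENNReal.ofReal_add measureReal_nonneg zero_le_one, ← ENNReal.ofReal_mul (by positivity),
    inv_mul_cancel₀ hpos.ne']

/-- The additional point contributes exp(0) - 1 = 0, so its extra unit of mass, which allows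
normalisation even for Λ = 0, leaves the Poisson exponent unchanged. -/
lemma integral_pointLaw (Λ : Measure E) [IsFiniteMeasure Λ] (f : SimpleFunc E ℝ) :
    ((Λ.real Set.univ + 1 : ℝ) : ℂ) *
      (∫ y, Complex.exp ((Sum.elim f (fun _ => 0) y : ℝ) * Complex.I) ∂pointLaw Λ - 1) =
      ∫ x, (Complex.exp (f x * Complex.I) - 1) ∂Λ := by
  have hpos : 0 < Λ.real Set.univ + 1 := by positivity
  have hpos' : ((Λ.real Set.univ + 1 : ℝ) : ℂ) ≠ 0 := Complex.ofReal_ne_zero.2 hpos.ne'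
  have hm : Measurable (Sum.elim f (fun _ => 0) : E ⊕ Unit → ℝ) :=
    f.measurable.sumElim measurable_const
  have hi : Integrable (fun x => Complex.exp (f x * Complex.I)) Λ :=
    Integrable.of_bound (C := 1) (Measurable.aestronglyMeasurable
      (by have := f.measurable; fun_prop))
      (ae_of_all _ fun _ => (Complex.norm_exp_ofReal_mul_I _).le)
  rw [pointLaw, integral_smul_measure, integral_add_measure (integrable_exp_elim _ f)
    (integrable_exp_elim _ f), integral_map measurable_inl.aemeasurable
    (Measurable.aestronglyMeasurable (by fun_prop)),
    integral_dirac' _ _ (Measurable.stronglyMeasurable (by fun_prop)),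
    integral_sub hi (integrable_const _), ENNReal.toReal_ofReal (by positivity)]
  simp only [Sum.elim_inl, Sum.elim_inr, Complex.ofReal_zero, zero_mul, Complex.exp_zero,
    integral_const, Complex.real_smul, mul_one, Complex.ofReal_inv]
  rw [mul_sub, mul_inv_cancel_left₀ hpos']
  push_cast
  ring

/-- The point law, diluted by moving the mass `1 - p` to the additional point. -/
def dilutedLaw (ν : Measure (E ⊕ Unit)) (p : ℝ) : Measure (E ⊕ Unit) :=
  ENNReal.ofReal p • ν + ENNReal.ofReal (1 - p) • Measure.dirac (Sum.inr ())

lemma isProbabilityMeasure_dilutedLaw (ν : Measure (E ⊕ Unit)) [IsProbabilityMeasure ν] {p : ℝ}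
    (h0 : 0 ≤ p) (h1 : p ≤ 1) : IsProbabilityMeasure (dilutedLaw ν p) := by
  refine ⟨?_⟩
  simp only [dilutedLaw, Measure.add_apply, Measure.smul_apply, measure_univ, smul_eq_mul, mul_one]
  rw [← ENNReal.ofReal_add h0 (by linarith)]
  simp

lemma integral_dilutedLaw (ν : Measure (E ⊕ Unit)) [IsProbabilityMeasure ν] {p : ℝ}
    (h0 : 0 ≤ p) (h1 : p ≤ 1) (f : SimpleFunc E ℝ) :
    ∫ y, Complex.exp ((Sum.elim f (fun _ => 0) y : ℝ) * Complex.I) ∂dilutedLaw ν p =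
      p * ∫ y, Complex.exp ((Sum.elim f (fun _ => 0) y : ℝ) * Complex.I) ∂ν + (1 - p : ℝ) := by
  have hm : Measurable (Sum.elim f (fun _ => 0) : E ⊕ Unit → ℝ) :=
    f.measurable.sumElim measurable_const
  rw [dilutedLaw, integral_add_measure
    ((integrable_exp_elim _ f).smul_measure ENNReal.ofReal_ne_top)
    ((integrable_exp_elim _ f).smul_measure ENNReal.ofReal_ne_top), integral_smul_measure,
    integral_smul_measure, integral_dirac' _ _ (Measurable.stronglyMeasurable (by fun_prop)),
    ENNReal.toReal_ofReal h0, ENNReal.toReal_ofReal (sub_nonneg.2 h1)]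
  simp

instance instIsProbabilityMeasureMapOfPoints (n : ℕ) (ν : Measure (E ⊕ Unit))
    [IsProbabilityMeasure ν] :
    IsProbabilityMeasure ((Measure.pi fun _ : Fin n => ν).map ofPoints) :=
  Measure.isProbabilityMeasure_map (measurable_ofPoints n).aemeasurable

/-- The counting measure of `n` diluted points is a binomial mixture. -/
lemma map_ofPoints_dilutedLaw [MeasurableSingletonClass E] (n : ℕ) (ν : Measure (E ⊕ Unit))
    [IsProbabilityMeasure ν] {p : ℝ} (h0 : 0 ≤ p) (h1 : p ≤ 1) :
    (Measure.pi fun _ : Fin n => dilutedLaw ν p).map ofPoints =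
      ∑ k ∈ Finset.range (n + 1), ENNReal.ofReal (n.choose k * p ^ k * (1 - p) ^ (n - k)) •
        (Measure.pi fun _ : Fin k => ν).map ofPoints := by
  have := isProbabilityMeasure_dilutedLaw ν h0 h1
  have hp : 0 ≤ 1 - p := sub_nonneg.2 h1
  have hfin : ∀ k, IsFiniteMeasure (ENNReal.ofReal (n.choose k * p ^ k * (1 - p) ^ (n - k)) •
        (Measure.pi fun _ : Fin k => ν).map ofPoints) := fun k =>
    Measure.smul_finite _ ENNReal.ofReal_ne_top
  refine ext_of_charFunctional fun f => ?_
  -- With u the one-point transform, both sides are (p u + (1 - p))^n, by the binomial theorem.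
  rw [charFunctional_map_ofPoints, integral_dilutedLaw ν h0 h1, add_pow, charFunctional,
    integral_finsetSum_measure fun k _ => integrable_exp_integral _ f]
  refine Finset.sum_congr rfl fun k _ => ?_
  rw [← charFunctional, charFunctional_smul _ (by positivity), charFunctional_map_ofPoints]
  push_cast
  ring

/-- The law of a Poisson process is a Poisson mixture of laws of independent points. -/
lemma map_poisson_eq_sum [MeasurableSingletonClass E] {Ω : Type*} [MeasurableSpace Ω]
    {P : Measure Ω} [IsProbabilityMeasure P] {Λ : Measure E} [IsFiniteMeasure Λ]
    {η : Ω → FiniteCountingMeasure E} (hη : IsPoissonProcess η Λ P) {r : ℝ}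
    (hr : r = Λ.real Set.univ + 1) :
    P.map η = Measure.sum fun k : ℕ => ENNReal.ofReal (Real.exp (-r) * r ^ k / k.factorial) •
      (Measure.pi fun _ : Fin k => pointLaw Λ).map ofPoints := by
  have hr0 : 0 ≤ r := by rw [hr]; positivity
  have hw : ∀ k : ℕ, 0 ≤ Real.exp (-r) * r ^ k / k.factorial := fun k => by positivity
  have hsum := hasSum_one_poissonMeasure ⟨r, hr0⟩
  have hfin : IsFiniteMeasure (Measure.sum fun k : ℕ =>
      ENNReal.ofReal (Real.exp (-r) * r ^ k / k.factorial) •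
        (Measure.pi fun _ : Fin k => pointLaw Λ).map ofPoints) := by
    refine ⟨?_⟩
    rw [Measure.sum_apply _ .univ]
    simp only [Measure.smul_apply, measure_univ, smul_eq_mul, mul_one]
    exact hsum.summable.tsum_ofReal_lt_top
  refine ext_of_charFunctional fun f => ?_
  set u := ∫ y, Complex.exp ((Sum.elim f (fun _ => 0) y : ℝ) * Complex.I) ∂pointLaw Λ with hu
  -- The mixture identity is the power series of exp(r(u - 1)) = exp(-r) exp(ru).
  have h := (NormedSpace.expSeries_div_hasSum_exp ((r : ℂ) * u)).mul_left (Complex.exp (-r))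
  rw [← Complex.exp_eq_exp_ℂ, ← Complex.exp_add] at h
  rw [charFunctional_poisson hη, ← integral_pointLaw, ← hr, ← hu,
    show (r : ℂ) * (u - 1) = -r + r * u by ring, ← h.tsum_eq, charFunctional,
    integral_sum_measure (integrable_exp_integral _ f)]
  refine tsum_congr fun k => ?_
  refine Eq.trans ?_ (charFunctional_smul _ (hw k) _ f).symm
  rw [charFunctional_map_ofPoints, ← hu]
  push_cast
  ring

/-- The concentration inequality for a Poisson process, in terms of its law. -/
theorem map_poisson_mul_le [StandardBorelSpace E] {Ω : Type*} [MeasurableSpace Ω]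
    {P : Measure Ω} [IsProbabilityMeasure P] {Λ : Measure E} [IsFiniteMeasure Λ]
    {η : Ω → FiniteCountingMeasure E} (hη : IsPoissonProcess η Λ P)
    {A : Set (FiniteCountingMeasure E)} (hA : MeasurableSet A) {s : ℝ} (hs : 0 ≤ s) :
    P.map η A * P.map η (parallelSet A s)ᶜ ≤ ENNReal.ofReal (Real.exp (-s ^ 2 / 4)) := by
  obtain ⟨r, hr⟩ : ∃ r, r = Λ.real Set.univ + 1 := ⟨_, rfl⟩
  have hr0 : 0 < r := by rw [hr]; positivity
  let M : ℕ → Measure (FiniteCountingMeasure E) := fun k =>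
    (Measure.pi fun _ : Fin k => pointLaw Λ).map ofPoints
  let w : ℕ → ℕ → ℝ := fun n k => n.choose k * (r / n) ^ k * (1 - r / n) ^ (n - k)
  let c : ℕ → ℝ := fun k => Real.exp (-r) * r ^ k / k.factorial
  have hwc : ∀ k, Tendsto (fun n => w n k) atTop (𝓝 (c k)) := by
    intro k
    refine tendsto_choose_mul_pow_of_tendsto_mul_atTop k (tendsto_const_nhds.congr' ?_)
    filter_upwards [eventually_ge_atTop 1] with n hn
    have : (n : ℝ) ≠ 0 := by positivity
    field_simp
  have hbinom : ∀ᶠ n : ℕ in atTop,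
      (∑ k ∈ Finset.range (n + 1), ENNReal.ofReal (w n k) * M k A) *
        (∑ k ∈ Finset.range (n + 1), ENNReal.ofReal (w n k) * M k (parallelSet A s)ᶜ) ≤
      ENNReal.ofReal (Real.exp (-s ^ 2 / 4)) := by
    filter_upwards [eventually_ge_atTop (max 1 ⌈r⌉₊)] with n hn
    have hn0 : (0 : ℝ) < n := by exact_mod_cast (le_max_left _ _).trans hn
    have hp0 : 0 ≤ r / n := by positivity
    have hp1 : r / n ≤ 1 :=
      (div_le_one hn0).2 (Nat.ceil_le.1 ((le_max_right _ _).trans hn))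
    have := isProbabilityMeasure_dilutedLaw (pointLaw Λ) hp0 hp1
    have h := map_ofPoints_mul_le (n := n) (dilutedLaw (pointLaw Λ) (r / n)) hA hs
    rw [map_ofPoints_dilutedLaw n (pointLaw Λ) hp0 hp1] at h
    simpa only [Measure.finsetSum_apply, Measure.smul_apply, smul_eq_mul] using h
  -- Dropping the terms k ≥ K only decreases the binomial product, and for fixed K the limit in n is
  -- termwise.
  have hpartial : ∀ K : ℕ, (∑ k ∈ Finset.range K, ENNReal.ofReal (c k) * M k A) *
        (∑ k ∈ Finset.range K, ENNReal.ofReal (c k) * M k (parallelSet A s)ᶜ) ≤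
      ENNReal.ofReal (Real.exp (-s ^ 2 / 4)) := by
    intro K
    have hlim : ∀ S, Tendsto (fun n => ∑ k ∈ Finset.range K, ENNReal.ofReal (w n k) * M k S) atTop
        (𝓝 (∑ k ∈ Finset.range K, ENNReal.ofReal (c k) * M k S)) := fun S =>
      tendsto_finsetSum _ fun k _ => ENNReal.Tendsto.mul_const
        (ENNReal.tendsto_ofReal (hwc k)) (Or.inr (measure_ne_top _ _))
    have hne : ∀ S, ∑ k ∈ Finset.range K, ENNReal.ofReal (c k) * M k S ≠ ⊤ := fun S =>
      ENNReal.sum_ne_top.2 fun k _ => ENNReal.mul_ne_top ENNReal.ofReal_ne_top (measure_ne_top _ _)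
    refine le_of_tendsto (ENNReal.Tendsto.mul (hlim A) (Or.inr (hne _)) (hlim _)
      (Or.inr (hne _))) ?_
    filter_upwards [hbinom, eventually_ge_atTop K] with n hn hKn
    refine le_trans ?_ hn
    have hsub : Finset.range K ⊆ Finset.range (n + 1) := Finset.range_mono (by omega)
    gcongr
  have hQ : ∀ S, Tendsto (fun K => ∑ k ∈ Finset.range K, ENNReal.ofReal (c k) * M k S) atTop
      (𝓝 (P.map η S)) := by
    intro S
    rw [map_poisson_eq_sum hη hr, Measure.sum_apply_of_countable]
    exact ENNReal.tendsto_nat_tsum _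
  exact le_of_tendsto' (ENNReal.Tendsto.mul (hQ A) (Or.inr (measure_ne_top _ _)) (hQ _)
    (Or.inr (measure_ne_top _ _))) hpartial

end FiniteCountingMeasure

end

theorem theorem1 {E : Type*} [TopologicalSpace E] [LocallyCompactSpace E]
    [SecondCountableTopology E] [T2Space E] [MeasurableSpace E] [BorelSpace E]
    {Ω : Type*} [MeasurableSpace Ω] (P : Measure Ω) [IsProbabilityMeasure P]
    (Λ : Measure E) [IsFiniteMeasure Λ]
    (η : Ω → FiniteCountingMeasure E) (hη : IsPoissonProcess η Λ P)
    (A : Set (FiniteCountingMeasure E)) (hA : MeasurableSet A) (s : ℝ) (hs : 0 ≤ s) :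
    P.real {ω | η ω ∈ A} * P.real {ω | η ω ∉ FiniteCountingMeasure.parallelSet A s} ≤
      Real.exp (-s ^ 2 / 4) := by
  have : PolishSpace E := polishSpace_of_locallyCompact E
  have h := FiniteCountingMeasure.map_poisson_mul_le hη hA hs
  rw [measureReal_def, measureReal_def, ← ENNReal.toReal_mul]
  refine ENNReal.toReal_le_of_le_ofReal (Real.exp_nonneg _) (le_trans ?_ h)
  -- For an arbitrary set, the outer measure of the preimage is at most the image measure of the
  -- set, which is the direction needed.
  exact mul_le_mul' (Measure.le_map_apply hη.measurable.aemeasurable A)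
    (Measure.le_map_apply hη.measurable.aemeasurable _)
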